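/- For integers $n,k\ge 1$, let $G_{n,k}$ be the uniform attachment graph: its vertex set is $\{1,\dots,n\}$; each vertex $j\in\{2,\dots,n\}$ makes $k$ independent uniform random choices (with repetition allowed) from $\{1,\dots,j-1\}$, the choices of different vertices being independent as well; and two distinct vertices are adjacent if and only if one of them chose the other at least once (so $G_{n,k}$ is a simple undirected graph). **Theorem 2.1.** With high probability, $G_{n,4}$ has a matching that contains all but a bounded number of vertices, in the following sense: for every function $\omega:\mathbb N\to\mathbb R$ with $\omega(n)\to\infty$ as $n\to\infty$, $$\lim_{n\to\infty}\mathbb P\bigl(G_{n,4}\text{ has a matching that leaves fewer than }\omega(n)\text{ vertices uncovered}\bigr)=1 .$$ -/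

import Mathlib

open MeasureTheory Filter Topology

noncomputable section

namespace UniformAttachment

/-- The possible outcomes of all choices in the uniform attachment process on `n` vertices with `k`
choices per vertex. The vertices, in order of arrival, are `0, 1, …, n - 1`; for `j < n - 1` and
`i < k`, the entry `z j i` is the `i`-th choice of vertex `j + 1`, an element of `{0, …, j}`.
Vertex `0` makes no choices. -/
abbrev Choices (n k : ℕ) : Type :=
  (j : Fin (n - 1)) → Fin k → Fin (j.val + 1)

/-- The law of the choices: all of them are independent, and each choice of vertex `j + 1` is
uniform on the set `{0, …, j}` of earlier vertices. -/
def choiceMeasure (n k : ℕ) : Measure (Choices n k) :=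
  Measure.pi fun j : Fin (n - 1) =>
    Measure.pi fun _ : Fin k => (PMF.uniformOfFintype (Fin (j.val + 1))).toMeasure

/-- The simple undirected graph on `{0, …, n - 1}` determined by the choices: distinct vertices are
adjacent iff one of them chose the other at least once. If `z` is distributed according to
`choiceMeasure n k`, this is the uniform attachment graph `G_{n,k}`. -/
def graph {n k : ℕ} (z : Choices n k) : SimpleGraph (Fin n) :=
  SimpleGraph.fromRel fun u v =>
    ∃ (j : Fin (n - 1)) (i : Fin k), v.val = j.val + 1 ∧ u.val = (z j i).val

end UniformAttachment

end

namespace UniformAttachment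

open scoped BigOperators

/-! Let the deficit be the number of vertices missed by a maximum matching, watched while the
vertices arrive one at a time. A new vertex raises it by at most one. If the deficit is positive and
the new vertex chooses some vertex of `D`, the set of vertices missed by at least one maximum
matching, the deficit falls by at least one. So it suffices that `D` is large enough for the deficit
to drift downwards.

The size of `D` comes from a Gallai–Edmonds type fact, `card_neighbors_missable_lt`: when the
deficit is positive, `D` has fewer external neighbours than elements. On the other hand, a union
bound over pairs (set, neighbourhood), `exists_expect_not_isExpanding_le`, shows that with
probability `1 - O(1/t^2)` no nonempty set of at most `0.16 (t + 1)` vertices has this property.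
Hence typically `|D| > 0.16 (t + 1)`, and four choices all avoid `D` with probability at most `0.84
^ 4 < 1/2`.

This bias makes `1.005 ^ deficit` contract in expectation up to an additive constant
(`expect_pow_deficit_le`), so it stays bounded as long as expansion holds. The failure probabilities
are summable, so failure after a large fixed time `s` has small probability, and Markov's inequality
gives a tail bound uniform in `n`. -/

/-- A matching of `G`, given as the involution that swaps the two ends of each of its edges and
fixes the uncovered vertices. -/
structure IsMatchingPerm {V : Type*} (G : SimpleGraph V) (σ : Equiv.Perm V) : Prop where
  invol : ∀ v, σ (σ v) = v
  adj : ∀ v, σ v ≠ v → G.Adj v (σ v)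

/-! ### Maximum matchings and missable vertices -/

section Matching

variable {V : Type*} {G : SimpleGraph V} {σ τ : Equiv.Perm V} {x y z : V}

theorem IsMatchingPerm.mono {G' : SimpleGraph V} (h : IsMatchingPerm G σ) (hG : G ≤ G') :
    IsMatchingPerm G' σ :=
  ⟨h.invol, fun v hv => hG (h.adj v hv)⟩

theorem isMatchingPerm_one (G : SimpleGraph V) : IsMatchingPerm G 1 :=
  ⟨fun _ => rfl, fun _ hv => absurd rfl hv⟩

/-- The graph `G` with the edges at `x` and `y` removed. -/
def isolatePair (G : SimpleGraph V) (x y : V) : SimpleGraph V where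
  Adj a b := G.Adj a b ∧ a ≠ x ∧ a ≠ y ∧ b ≠ x ∧ b ≠ y
  symm := ⟨fun _ _ h => ⟨h.1.symm, h.2.2.2.1, h.2.2.2.2, h.2.1, h.2.2.1⟩⟩
  loopless := ⟨fun _ h => h.1.ne rfl⟩

theorem isolatePair_le : isolatePair G x y ≤ G := fun _ _ h => h.1

theorem IsMatchingPerm.isolatePair_left (h : IsMatchingPerm (isolatePair G x y) σ) : σ x = x := by
  by_contra hx
  exact (h.adj x hx).2.1 rfl

theorem IsMatchingPerm.isolatePair_right (h : IsMatchingPerm (isolatePair G x y) σ) :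
    σ y = y := by
  by_contra hy
  exact (h.adj y hy).2.2.1 rfl

theorem IsMatchingPerm.isolatePair (h : IsMatchingPerm G σ) (hx : σ x = x) (hy : σ y = y) :
    IsMatchingPerm (isolatePair G x y) σ :=
  ⟨h.invol, fun v hv => ⟨h.adj v hv, fun e => hv (by rw [e, hx]), fun e => hv (by rw [e, hy]),
    fun e => hv (σ.injective (by rw [e, hx])), fun e => hv (σ.injective (by rw [e, hy]))⟩⟩

variable [DecidableEq V]

theorem IsMatchingPerm.mul_swap_apply_of_ne (v : V) (hx : v ≠ x) (hy : v ≠ y) :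
    (σ * Equiv.swap x y) v = σ v := by
  rw [Equiv.Perm.mul_apply, Equiv.swap_apply_of_ne_of_ne hx hy]

/-- Adding an edge between two uncovered vertices. -/
theorem IsMatchingPerm.add (h : IsMatchingPerm G σ) (hx : σ x = x) (hy : σ y = y)
    (hxy : G.Adj x y) : IsMatchingPerm G (σ * Equiv.swap x y) := by
  have key : ∀ v, v ≠ x → v ≠ y → (σ v ≠ x ∧ σ v ≠ y) := fun v hvx hvy =>
    ⟨fun e => hvx (σ.injective (e.trans hx.symm)), fun e => hvy (σ.injective (e.trans hy.symm))⟩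
  refine ⟨fun v => ?_, fun v hv => ?_⟩
  · by_cases hvx : v = x
    · subst hvx; simp [hx, hy]
    by_cases hvy : v = y
    · subst hvy; simp [hx, hy]
    obtain ⟨h1, h2⟩ := key v hvx hvy
    rw [mul_swap_apply_of_ne v hvx hvy, mul_swap_apply_of_ne _ h1 h2, h.invol]
  · by_cases hvx : v = x
    · subst hvx; simpa [hy] using hxy
    by_cases hvy : v = y
    · subst hvy; simpa [hx] using hxy.symm
    rw [mul_swap_apply_of_ne v hvx hvy] at hv ⊢
    exact h.adj v hv

/-- Removing an edge. -/
theorem IsMatchingPerm.remove (h : IsMatchingPerm G σ) (hyz : σ y = z) :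
    IsMatchingPerm G (σ * Equiv.swap y z) := by
  have hzy : σ z = y := by rw [← hyz, h.invol]
  have key : ∀ v, v ≠ y → v ≠ z → (σ v ≠ y ∧ σ v ≠ z) := fun v hvy hvz =>
    ⟨fun e => hvz (σ.injective (e.trans hzy.symm)), fun e => hvy (σ.injective (e.trans hyz.symm))⟩
  refine ⟨fun v => ?_, fun v hv => ?_⟩
  · by_cases hvy : v = y
    · subst hvy; simp [hzy]
    by_cases hvz : v = z
    · subst hvz; simp [hyz]
    obtain ⟨h1, h2⟩ := key v hvy hvz
    rw [mul_swap_apply_of_ne v hvy hvz, mul_swap_apply_of_ne _ h1 h2, h.invol]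
  · by_cases hvy : v = y
    · subst hvy; simp [hzy] at hv
    by_cases hvz : v = z
    · subst hvz; simp [hyz] at hv
    rw [mul_swap_apply_of_ne v hvy hvz] at hv ⊢
    exact h.adj v hv

variable [Fintype V]

theorem card_support_mul_swap (hx : σ x = x) (hy : σ y = y) (hxy : x ≠ y) :
    (σ * Equiv.swap x y).support.card = σ.support.card + 2 := by
  have hd : Equiv.Perm.Disjoint σ (Equiv.swap x y) := by
    intro v
    by_cases hvx : v = x
    · subst hvx; exact Or.inl hx
    by_cases hvy : v = y
    · subst hvy; exact Or.inl hy
    exact Or.inr (Equiv.swap_apply_of_ne_of_ne hvx hvy)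
  rw [hd.card_support_mul, Equiv.Perm.card_support_swap hxy]

theorem IsMatchingPerm.card_support_remove (h : IsMatchingPerm G σ) (hyz : σ y = z) (hne : z ≠ y) :
    (σ * Equiv.swap y z).support.card + 2 = σ.support.card := by
  have hzy : σ z = y := by rw [← hyz, h.invol]
  have := card_support_mul_swap (σ := σ * Equiv.swap y z) (x := y) (y := z)
    (by simp [hzy]) (by simp [hyz]) hne.symm
  rw [← this, mul_assoc, Equiv.swap_mul_self, mul_one]

/-- A matching covering as many vertices as possible. -/
structure IsMaxMatchingPerm (G : SimpleGraph V) (σ : Equiv.Perm V) : Prop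
    extends IsMatchingPerm G σ where
  le : ∀ τ, IsMatchingPerm G τ → τ.support.card ≤ σ.support.card

/-- A vertex is missable if some maximum matching leaves it uncovered. -/
def Missable (G : SimpleGraph V) (v : V) : Prop :=
  ∃ σ, IsMaxMatchingPerm G σ ∧ σ v = v

theorem exists_isMaxMatchingPerm (G : SimpleGraph V) : ∃ σ, IsMaxMatchingPerm G σ := by
  classical
  obtain ⟨σ, hσ, hmax⟩ := Finset.exists_max_image
    (Finset.univ.filter fun σ : Equiv.Perm V => IsMatchingPerm G σ) (fun σ => σ.support.card)
    ⟨1, by simpa using isMatchingPerm_one G⟩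
  exact ⟨σ, (Finset.mem_filter.1 hσ).2, fun τ hτ => hmax τ (by simpa using hτ)⟩

theorem IsMaxMatchingPerm.not_adj (h : IsMaxMatchingPerm G σ) (hx : σ x = x) (hy : σ y = y) :
    ¬ G.Adj x y := fun hxy => by
  have h1 := h.le _ (h.add hx hy hxy)
  rw [card_support_mul_swap hx hy hxy.ne] at h1
  omega

theorem IsMaxMatchingPerm.of_card_le (h : IsMaxMatchingPerm G σ) (hτ : IsMatchingPerm G τ)
    (hc : σ.support.card ≤ τ.support.card) : IsMaxMatchingPerm G τ :=
  ⟨hτ, fun ρ hρ => (h.le ρ hρ).trans hc⟩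

/-- Exchanging the edge from `y` to `σ y` for the edge `xy` keeps the size and frees `σ y`. -/
theorem IsMaxMatchingPerm.missable_of_adj (h : IsMaxMatchingPerm G σ) (hx : σ x = x)
    (hxy : G.Adj x y) : Missable G (σ y) := by
  have hy : σ y ≠ y := fun hy => h.not_adj hx hy hxy
  have hzx : σ y ≠ x := fun e => hxy.ne' (σ.injective (e.trans hx.symm))
  have hyx := hxy.ne'
  set ρ := σ * Equiv.swap y (σ y) with hρ
  have hρm : IsMatchingPerm G ρ := h.remove rfl
  have hρx : ρ x = x := by
    rw [hρ, IsMatchingPerm.mul_swap_apply_of_ne x hxy.ne hzx.symm, hx]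
  have hρy : ρ y = y := by simp [hρ, h.invol]
  have hρz : ρ (σ y) = σ y := by simp [hρ]
  refine ⟨ρ * Equiv.swap x y, h.of_card_le (hρm.add hρx hρy hxy) ?_, ?_⟩
  · rw [card_support_mul_swap hρx hρy hxy.ne, hρ, h.card_support_remove rfl hy]
  · rw [IsMatchingPerm.mul_swap_apply_of_ne _ hzx hy, hρz]

/-- Given a maximum matching `τ` missing `x` and a maximum matching `σ` with an edge `yz`, one of
`y`, `z` is missable or some maximum matching both misses `x` and contains `yz`. -/
theorem IsMaxMatchingPerm.missable_or_exists (hσ : IsMaxMatchingPerm G σ)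
    (hτ : IsMaxMatchingPerm G τ) (hx : τ x = x) (hyz : σ y = z) (hne : z ≠ y) :
    Missable G y ∨ Missable G z ∨ ∃ ρ, IsMaxMatchingPerm G ρ ∧ ρ x = x ∧ ρ y = z := by
  induction hk : σ.support.card using Nat.strong_induction_on generalizing G σ τ x with
  | _ k ih =>
  by_cases hσx : σ x = x
  · exact Or.inr (Or.inr ⟨σ, hσ, hσx, hyz⟩)
  -- Follow the alternating path of `σ` and `τ` from `x`: `p` is the `σ`-partner of `x`, then `q`
  -- the `τ`-partner of `p`. Deleting `x` and `p` leaves the same situation with `q` in the role of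
  -- `x`.
  set p := σ x with hp
  have hpx : σ p = x := by rw [hp, hσ.invol]
  have hzy : σ z = y := by rw [← hyz, hσ.invol]
  by_cases hpy : p = y
  · refine Or.inr (Or.inl ⟨τ, hτ, ?_⟩)
    rw [← hyz, ← hpy, hpx, hx]
  by_cases hyx : y = x
  · exact Or.inl ⟨τ, hτ, by rw [hyx, hx]⟩
  have hzx : z ≠ x := fun e => hpy (by rw [hp, ← e, hzy])
  have hzp : z ≠ p := fun e => hyx (by rw [← hzy, e, hpx])
  have hxp : G.Adj x p := hσ.adj x hσx
  have hτp : τ p ≠ p := fun e => hτ.not_adj hx e hxp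
  set q := τ p with hq
  have hqx : q ≠ x := fun e => hσx (τ.injective (by rw [← hq, e, hx]))
  have hτq : τ q = p := by rw [hq, hτ.invol]
  have hcard : σ.support.card = τ.support.card := le_antisymm (hτ.le _ hσ.1) (hσ.le _ hτ.1)
  set σ' := σ * Equiv.swap x p with hσ'
  set τ' := τ * Equiv.swap p q with hτ'
  have cσ : σ'.support.card + 2 = σ.support.card := hσ.card_support_remove hp.symm hσx
  have cτ : τ'.support.card + 2 = τ.support.card := hτ.card_support_remove hq.symm hτp
  have hσ'm : IsMatchingPerm (UniformAttachment.isolatePair G x p) σ' :=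
    (hσ.remove hp.symm).isolatePair (by simp [hpx]) (by simp [← hp])
  have hτ'x : τ' x = x := by
    rw [hτ', IsMatchingPerm.mul_swap_apply_of_ne x (Ne.symm hσx) hqx.symm, hx]
  have hτ'm : IsMatchingPerm (UniformAttachment.isolatePair G x p) τ' :=
    (hτ.remove hq.symm).isolatePair hτ'x (by simp [hτq])
  have lift : ∀ ρ, IsMatchingPerm (UniformAttachment.isolatePair G x p) ρ →
      IsMatchingPerm G (ρ * Equiv.swap x p) ∧
        (ρ * Equiv.swap x p).support.card = ρ.support.card + 2 := fun ρ hρ =>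
    ⟨(hρ.mono isolatePair_le).add hρ.isolatePair_left hρ.isolatePair_right hxp,
      card_support_mul_swap hρ.isolatePair_left hρ.isolatePair_right hxp.ne⟩
  -- Restoring the edge `xp` turns a matching of the reduced graph into one of `G` with two more
  -- covered vertices, so maximality passes down.
  have hσ'max : IsMaxMatchingPerm (UniformAttachment.isolatePair G x p) σ' := by
    refine ⟨hσ'm, fun ρ hρ => ?_⟩
    have h1 := hσ.le _ (lift ρ hρ).1
    rw [(lift ρ hρ).2] at h1
    omega
  have hτ'max := hσ'max.of_card_le hτ'm (by omega)
  have hσ'y : σ' y = z := by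
    rw [hσ', IsMatchingPerm.mul_swap_apply_of_ne y hyx (Ne.symm hpy), hyz]
  have missable : ∀ w, w ≠ x → w ≠ p → Missable (UniformAttachment.isolatePair G x p) w →
      Missable G w := by
    rintro w hwx hwp ⟨ρ, hρ, hw⟩
    refine ⟨_, hσ.of_card_le (lift ρ hρ.1).1 ?_, ?_⟩
    · have := hρ.le _ hσ'm
      rw [(lift ρ hρ.1).2]
      omega
    · rw [IsMatchingPerm.mul_swap_apply_of_ne w hwx hwp, hw]
  rcases ih σ'.support.card (by omega) hσ'max hτ'max (x := q) (by simp [hτ', ← hq]) hσ'y rfl with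
    h | h | ⟨ρ, hρ, hρq, hρy⟩
  · exact Or.inl (missable y hyx (Ne.symm hpy) h)
  · exact Or.inr (Or.inl (missable z hzx hzp h))
  -- Here the edge `pq` is restored instead of `xp`, so that `x` stays uncovered.
  · have hρp := hρ.isolatePair_right
    have hpq : G.Adj p q := hτ.adj p hτp
    refine Or.inr (Or.inr ⟨ρ * Equiv.swap p q, hσ.of_card_le
      ((hρ.toIsMatchingPerm.mono isolatePair_le).add hρp hρq hpq) ?_, ?_, ?_⟩)
    · have := hρ.le _ hσ'm
      rw [card_support_mul_swap hρp hρq hpq.ne]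
      omega
    · rw [IsMatchingPerm.mul_swap_apply_of_ne x (Ne.symm hσx) hqx.symm, hρ.isolatePair_left]
    · have hyq : y ≠ q := fun e => hne (by rw [← hρy, e, hρq])
      rw [IsMatchingPerm.mul_swap_apply_of_ne y (Ne.symm hpy) hyq, hρy]

/-- The partner, in any maximum matching, of a non-missable neighbour of a missable vertex is
missable. -/
theorem IsMaxMatchingPerm.missable_apply (hσ : IsMaxMatchingPerm G σ) (hx : Missable G x)
    (hxy : G.Adj x y) (hy : ¬ Missable G y) : Missable G (σ y) := by
  obtain ⟨τ, hτ, hτx⟩ := hx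
  rcases hσ.missable_or_exists hτ hτx (y := y) rfl (fun e => hy ⟨σ, hσ, e⟩) with
    h | h | ⟨ρ, hρ, hρx, hρy⟩
  · exact absurd h hy
  · exact h
  · rw [← hρy]
    exact hρ.missable_of_adj hρx hxy

/-- The number of vertices covered by a maximum matching. -/
noncomputable def matchingSize (G : SimpleGraph V) : ℕ :=
  (exists_isMaxMatchingPerm G).choose.support.card

theorem IsMaxMatchingPerm.card_support (h : IsMaxMatchingPerm G σ) :
    σ.support.card = matchingSize G :=
  have h' := (exists_isMaxMatchingPerm G).choose_spec
  le_antisymm (h'.le _ h.1) (h.le _ h'.1)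

theorem IsMatchingPerm.card_support_le (h : IsMatchingPerm G σ) :
    σ.support.card ≤ matchingSize G :=
  (exists_isMaxMatchingPerm G).choose_spec.le _ h

theorem matchingSize_mono {G' : SimpleGraph V} (h : G ≤ G') : matchingSize G ≤ matchingSize G' := by
  obtain ⟨σ, hσ⟩ := exists_isMaxMatchingPerm G
  rw [← hσ.card_support]
  exact (hσ.1.mono h).card_support_le

/-- Joining an isolated vertex to a missable vertex enlarges the maximum matching. -/
theorem matchingSize_add_two_le {G' : SimpleGraph V} (h : G ≤ G') (hx : Missable G x)
    (hy : ∀ w, ¬ G.Adj y w) (hxy : G'.Adj x y) : matchingSize G + 2 ≤ matchingSize G' := by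
  obtain ⟨σ, hσ, hσx⟩ := hx
  have hσy : σ y = y := by
    by_contra e
    exact hy _ (hσ.adj y e)
  rw [← hσ.card_support, ← card_support_mul_swap hσx hσy hxy.ne]
  exact ((hσ.1.mono h).add hσx hσy hxy).card_support_le

open Classical in
/-- The vertices outside `A` that have a neighbour in `A`. -/
noncomputable def externalNeighbors (G : SimpleGraph V) (A : Finset V) : Finset V :=
  Finset.univ.filter fun y => y ∉ A ∧ ∃ x ∈ A, G.Adj x y

open Classical in
/-- If all edges lie in `S` and no matching covers `S`, then the set of missable vertices in `S` has
fewer neighbours than elements. -/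
theorem card_neighbors_missable_lt {S : Finset V} (hS : ∀ v w, G.Adj v w → v ∈ S)
    (hlt : matchingSize G < S.card) :
    (externalNeighbors G (S.filter (Missable G))).card < (S.filter (Missable G)).card := by
  obtain ⟨σ, hσ⟩ := exists_isMaxMatchingPerm G
  obtain ⟨v, hvS, hv⟩ : ∃ v ∈ S, v ∉ σ.support := by
    by_contra! hcon
    have := Finset.card_le_card (show S ⊆ σ.support from hcon)
    rw [hσ.card_support] at this
    omega
  rw [Equiv.Perm.notMem_support] at hv
  have hvD : v ∈ S.filter (Missable G) := Finset.mem_filter.2 ⟨hvS, σ, hσ, hv⟩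
  have hnm : ∀ y, y ∉ S.filter (Missable G) → ∀ x, G.Adj x y → ¬ Missable G y :=
    fun y hy x hxy h => hy (Finset.mem_filter.2 ⟨hS y x hxy.symm, h⟩)
  -- The injection `σ` sends external neighbours of `D` into `D`, and its image omits the uncovered
  -- vertex `v`, which gives strictness.
  rw [← Finset.card_map σ.toEmbedding]
  refine Finset.card_lt_card ⟨fun w hw => ?_, fun hsub => ?_⟩
  · obtain ⟨y, hy, rfl⟩ := Finset.mem_map.1 hw
    obtain ⟨-, hyD, x, hx, hxy⟩ := Finset.mem_filter.1 hy
    have hyM := hnm y hyD x hxy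
    have hne : σ y ≠ y := fun e => hyM ⟨σ, hσ, e⟩
    exact Finset.mem_filter.2 ⟨hS _ _ (hσ.adj y hne).symm,
      hσ.missable_apply (Finset.mem_filter.1 hx).2 hxy hyM⟩
  · obtain ⟨y, hy, hyv⟩ := Finset.mem_map.1 (hsub hvD)
    obtain ⟨-, hyD, x, hx, hxy⟩ := Finset.mem_filter.1 hy
    have hyv' : y = v := σ.injective (by rw [hv]; exact hyv)
    exact hyD (hyv' ▸ hvD)

/-- A permutation matching gives a matching subgraph with the same covered vertices. -/
theorem IsMatchingPerm.exists_subgraph (h : IsMatchingPerm G σ) :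
    ∃ M : G.Subgraph, M.IsMatching ∧ M.verts = (σ.support : Set V) := by
  refine ⟨{ verts := σ.support
            Adj := fun a b => σ a = b ∧ a ≠ b
            adj_sub := fun {a b} hab => by
              have := h.adj a (by rw [hab.1]; exact hab.2.symm)
              rwa [hab.1] at this
            edge_vert := fun {a b} hab => by
              simpa [hab.1] using hab.2.symm
            symm := ⟨fun a b hab => ⟨by rw [← hab.1, h.invol], hab.2.symm⟩⟩ }, ?_, rfl⟩
  intro v hv
  have hv' : σ v ≠ v := by simpa using hv
  exact ⟨σ v, ⟨rfl, hv'.symm⟩, fun w hw => hw.1.symm⟩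

end Matching

/-! ### Evolution of the graph and of its deficit -/

/-- The graph at time `t`: only the choices of the vertices `1, …, t` are taken into account. -/
def partialGraph {n k : ℕ} (z : Choices n k) (t : ℕ) : SimpleGraph (Fin n) :=
  SimpleGraph.fromRel fun u v =>
    ∃ (j : Fin (n - 1)) (i : Fin k), j.val < t ∧ v.val = j.val + 1 ∧ u.val = (z j i).val

/-- The vertices `0, …, t`. -/
def activeVertices (n t : ℕ) : Finset (Fin n) :=
  Finset.univ.filter fun v => v.val ≤ t

/-- The number of vertices among `0, …, t` left uncovered by a maximum matching at time `t`. -/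
noncomputable def deficit {n k : ℕ} (z : Choices n k) (t : ℕ) : ℕ :=
  t + 1 - matchingSize (partialGraph z t)

/-- At time `t`, every nonempty set of at most `0.16 (t + 1)` vertices has at least as many
external neighbours as elements. -/
def IsExpanding {n k : ℕ} (z : Choices n k) (t : ℕ) : Prop :=
  ∀ A ⊆ activeVertices n t, A.Nonempty → (A.card : ℝ) ≤ 0.16 * (t + 1) →
    A.card ≤ (externalNeighbors (partialGraph z t) A).card

section Evolution

variable {n k : ℕ} {z : Choices n k} {t : ℕ}

theorem partialGraph_sub_one (z : Choices n k) : partialGraph z (n - 1) = graph z := by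
  unfold partialGraph graph
  congr 1
  ext u v
  exact ⟨fun ⟨j, i, _, h⟩ => ⟨j, i, h⟩, fun ⟨j, i, h⟩ => ⟨j, i, j.isLt, h⟩⟩

theorem partialGraph_mono (z : Choices n k) {s t : ℕ} (h : s ≤ t) :
    partialGraph z s ≤ partialGraph z t := by
  rintro u v ⟨hne, ⟨j, i, hj, h1⟩ | ⟨j, i, hj, h1⟩⟩
  · exact ⟨hne, Or.inl ⟨j, i, hj.trans_le h, h1⟩⟩
  · exact ⟨hne, Or.inr ⟨j, i, hj.trans_le h, h1⟩⟩

theorem partialGraph_congr {z' : Choices n k} (h : ∀ j : Fin (n - 1), j.val < t → z j = z' j) :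
    partialGraph z t = partialGraph z' t := by
  unfold partialGraph
  congr 1
  ext u v
  constructor
  · rintro ⟨j, i, hj, h1, h2⟩
    exact ⟨j, i, hj, h1, by rw [h2, h j hj]⟩
  · rintro ⟨j, i, hj, h1, h2⟩
    exact ⟨j, i, hj, h1, by rw [h2, h j hj]⟩

theorem partialGraph_update (z : Choices n k) {m : Fin (n - 1)} (h : t ≤ m.val)
    (w : Fin k → Fin (m.val + 1)) :
    partialGraph (Function.update z m w) t = partialGraph z t :=
  partialGraph_congr fun j hj => by
    rw [Function.update_of_ne]
    rintro rfl
    omega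

theorem deficit_update (z : Choices n k) {m : Fin (n - 1)} (h : t ≤ m.val)
    (w : Fin k → Fin (m.val + 1)) : deficit (Function.update z m w) t = deficit z t := by
  rw [deficit, deficit, partialGraph_update z h]

theorem isExpanding_update (z : Choices n k) {m : Fin (n - 1)} (h : t ≤ m.val)
    (w : Fin k → Fin (m.val + 1)) : IsExpanding (Function.update z m w) t ↔ IsExpanding z t := by
  rw [IsExpanding, IsExpanding, partialGraph_update z h]

theorem partialGraph_adj_mem {u v : Fin n} (h : (partialGraph z t).Adj u v) :
    u ∈ activeVertices n t := by
  simp only [activeVertices, Finset.mem_filter, Finset.mem_univ, true_and]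
  obtain ⟨-, ⟨j, i, hj, h1, h2⟩ | ⟨j, i, hj, h1, h2⟩⟩ := h
  · have := (z j i).isLt
    omega
  · omega

theorem card_activeVertices (ht : t + 1 ≤ n) : (activeVertices n t).card = t + 1 := by
  have : activeVertices n t = Finset.univ.map (Fin.castLEEmb ht) := by
    ext v
    simp only [activeVertices, Finset.mem_filter, Finset.mem_univ, true_and, Finset.mem_map]
    constructor
    · intro hv
      exact ⟨⟨v.val, by omega⟩, rfl⟩
    · rintro ⟨a, rfl⟩
      have := a.isLt
      simp only [Fin.castLEEmb_apply, Fin.val_castLE]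
      omega
  rw [this, Finset.card_map, Finset.card_univ, Fintype.card_fin]

theorem deficit_le (z : Choices n k) (t : ℕ) : deficit z t ≤ t + 1 := Nat.sub_le _ _

theorem deficit_succ_le (z : Choices n k) (t : ℕ) : deficit z (t + 1) ≤ deficit z t + 1 := by
  have := matchingSize_mono (partialGraph_mono z (Nat.le_succ t))
  simp only [deficit, Nat.succ_eq_add_one] at this ⊢
  omega

open Classical in
/-- The vertices among `0, …, t` missed by some maximum matching at time `t`. -/
noncomputable def missableVertices {n k : ℕ} (z : Choices n k) (t : ℕ) : Finset (Fin n) :=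
  (activeVertices n t).filter (Missable (partialGraph z t))

theorem mem_missableVertices {v : Fin n} :
    v ∈ missableVertices z t ↔ v ∈ activeVertices n t ∧ Missable (partialGraph z t) v := by
  classical
  rw [missableVertices, Finset.mem_filter]

/-- A positive deficit gives the missable set fewer external neighbours than elements, which
expansion forbids for small sets. -/
theorem lt_card_missableVertices (ht : t + 1 ≤ n) (hz : IsExpanding z t) (hd : 0 < deficit z t) :
    0.16 * ((t : ℝ) + 1) < (missableVertices z t).card := by
  have hlt := card_neighbors_missable_lt (G := partialGraph z t) (S := activeVertices n t)
    (fun v w h => partialGraph_adj_mem h) (by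
      rw [card_activeVertices ht]
      simp only [deficit] at hd
      omega)
  by_contra! hle
  have h2 := hz (missableVertices z t) (fun v hv => (mem_missableVertices.1 hv).1)
    (Finset.card_pos.1 (lt_of_le_of_lt (Nat.zero_le _) hlt)) hle
  exact absurd hlt (not_lt.2 h2)

/-- If the new vertex chooses a missable vertex, the deficit decreases. -/
theorem deficit_succ_add_one_le (m : Fin (n - 1)) (i : Fin k) {v : Fin n}
    (hv : v ∈ missableVertices z m.val) (hi : v.val = (z m i).val) (hd : 0 < deficit z m.val) :
    deficit z (m.val + 1) + 1 ≤ deficit z m.val := by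
  have hm := m.isLt
  have hadj : (partialGraph z (m.val + 1)).Adj v ⟨m.val + 1, by omega⟩ := by
    refine ⟨fun e => ?_, Or.inl ⟨m, i, by omega, rfl, hi⟩⟩
    have := (z m i).isLt
    have := congrArg Fin.val e
    simp only at this
    omega
  have := matchingSize_add_two_le (partialGraph_mono z (Nat.le_succ m.val))
    (mem_missableVertices.1 hv).2 (fun w hw => ?_) hadj
  · simp only [deficit, Nat.succ_eq_add_one] at this hd ⊢
    omega
  · have := partialGraph_adj_mem hw
    simp [activeVertices] at this

end Evolution

/-! ### Uniform averages over product spaces -/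

section Expectation

/-- Resampling one coordinate preserves the uniform law: swapping the old coordinate with the fresh
one is an involution. -/
theorem expect_update {ι : Type*} [Fintype ι] [DecidableEq ι] {β : ι → Type*}
    [∀ i, Fintype (β i)] [∀ i, Nonempty (β i)] (m : ι) (F : (∀ i, β i) → ℝ) :
    𝔼 z, F z = 𝔼 z, 𝔼 w : β m, F (Function.update z m w) := by
  let e : ((∀ i, β i) × β m) ≃ ((∀ i, β i) × β m) :=
    { toFun := fun p => (Function.update p.1 m p.2, p.1 m)
      invFun := fun p => (Function.update p.1 m p.2, p.1 m)
      left_inv := fun p => by simp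
      right_inv := fun p => by simp }
  have h1 : ∑ p : (∀ i, β i) × β m, F (Function.update p.1 m p.2)
      = ∑ p : (∀ i, β i) × β m, F p.1 := Equiv.sum_comp e (fun p => F p.1)
  rw [Fintype.sum_prod_type, Fintype.sum_prod_type] at h1
  simp only [Finset.sum_const, Finset.card_univ, nsmul_eq_mul] at h1
  simp only [Fintype.expect_eq_sum_div_card, ← Finset.sum_div]
  rw [h1, ← Finset.mul_sum]
  have : (Fintype.card (β m) : ℝ) ≠ 0 := by exact_mod_cast Fintype.card_ne_zero
  field_simp

theorem expect_indicator_pi {k m : ℕ} (T : Finset (Fin (m + 1))) :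
    𝔼 w : Fin k → Fin (m + 1), (if ∀ i, w i ∈ T then (1 : ℝ) else 0)
      = ((T.card : ℝ) / (m + 1)) ^ k := by
  rw [Fintype.expect_eq_sum_div_card, Finset.sum_boole]
  have : (Finset.univ.filter fun w : Fin k → Fin (m + 1) => ∀ i, w i ∈ T)
      = Fintype.piFinset fun _ => T := by
    ext w; simp
  rw [this, Fintype.card_piFinset]
  simp [div_pow]

end Expectation

/-! ### Negative drift of the deficit -/

section Drift

variable {n k : ℕ} {z : Choices n k}

/-- The probability that the choices of a new vertex all avoid a set `D` of earlier vertices. -/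
theorem expect_avoid (m : Fin (n - 1)) (D : Finset (Fin n)) (hD : D ⊆ activeVertices n m.val) :
    𝔼 w : Fin k → Fin (m.val + 1),
        (if ∀ i, ∀ v ∈ D, v.val ≠ (w i).val then (1 : ℝ) else 0)
      = (1 - (D.card : ℝ) / (m.val + 1)) ^ k := by
  have hm := m.isLt
  have hle : m.val + 1 ≤ n := by omega
  set T : Finset (Fin (m.val + 1)) :=
    Finset.univ.filter fun x => ∀ v ∈ D, v.val ≠ x.val with hT
  have hcard : Tᶜ.card = D.card := by
    rw [← Finset.card_map (Fin.castLEEmb hle)]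
    congr 1
    ext v
    simp only [hT, Finset.mem_map, Finset.mem_compl, Finset.mem_filter, Finset.mem_univ, true_and]
    push Not
    constructor
    · rintro ⟨x, ⟨u, hu, hux⟩, rfl⟩
      have : Fin.castLEEmb hle x = u := Fin.ext hux.symm
      rwa [this]
    · intro hv
      have := hD hv
      simp only [activeVertices, Finset.mem_filter, Finset.mem_univ, true_and] at this
      exact ⟨⟨v.val, by omega⟩, ⟨v, hv, rfl⟩, rfl⟩
  have h1 := expect_indicator_pi (k := k) T
  have h2 := Finset.card_add_card_compl T
  rw [hcard, Fintype.card_fin] at h2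
  have h3 : (T.card : ℝ) + D.card = m.val + 1 := by exact_mod_cast h2
  have h4 : (1 - (D.card : ℝ) / (m.val + 1)) = (T.card : ℝ) / (m.val + 1) := by
    have : (m.val : ℝ) + 1 ≠ 0 := by positivity
    field_simp
    linarith
  rw [h4, ← h1]
  refine Finset.expect_congr rfl fun w _ => ?_
  simp [hT]

/-- The exponential moment of the deficit contracts in expectation. -/
theorem expect_pow_deficit_le {z : Choices n 4} (m : Fin (n - 1)) (hz : IsExpanding z m.val) :
    𝔼 w : Fin 4 → Fin (m.val + 1), (1.005 : ℝ) ^ deficit (Function.update z m w) (m.val + 1)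
      ≤ 0.999995 * (1.005 : ℝ) ^ deficit z m.val + 1.005 := by
  have hm := m.isLt
  rcases Nat.eq_zero_or_pos (deficit z m.val) with h0 | hpos
  -- With deficit `0` there is no drift to use; the next deficit is at most `1`, whence the additive
  -- `1.005`.
  · refine (Finset.expect_le_expect (g := fun _ => (1.005 : ℝ)) fun w _ => ?_).trans ?_
    · have := deficit_succ_le (Function.update z m w) m.val
      rw [deficit_update z le_rfl, h0] at this
      calc (1.005 : ℝ) ^ deficit (Function.update z m w) (m.val + 1) ≤ 1.005 ^ 1 :=
            pow_le_pow_right₀ (by norm_num) (by omega)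
        _ = 1.005 := pow_one _
    · rw [Finset.expect_const Finset.univ_nonempty]
      have : (0 : ℝ) ≤ 0.999995 * (1.005 : ℝ) ^ deficit z m.val := by positivity
      linarith
  · set D := missableVertices z m.val with hD
    set u := deficit z m.val with hu
    have hDc := lt_card_missableVertices (by omega) hz hpos
    have hDsub : D ⊆ activeVertices n m.val :=
      fun v hv => (mem_missableVertices.1 hv).1
    have hDle : (D.card : ℝ) ≤ m.val + 1 := by
      have := Finset.card_le_card hDsub
      rw [card_activeVertices (by omega)] at this
      exact_mod_cast this
    -- The exponent is at most `u + 1` when all choices avoid `D`, and at most `u - 1` otherwise.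
    have hpt : ∀ w : Fin 4 → Fin (m.val + 1),
        (1.005 : ℝ) ^ deficit (Function.update z m w) (m.val + 1) ≤
          (1.005 : ℝ) ^ u * (1.005)⁻¹ + ((1.005 : ℝ) ^ u * (1.005 - (1.005)⁻¹)) *
            (if ∀ i, ∀ v ∈ D, v.val ≠ (w i).val then (1 : ℝ) else 0) := by
      intro w
      split_ifs with h
      · have := deficit_succ_le (Function.update z m w) m.val
        rw [deficit_update z le_rfl, ← hu] at this
        calc (1.005 : ℝ) ^ deficit (Function.update z m w) (m.val + 1) ≤ 1.005 ^ (u + 1) :=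
            pow_le_pow_right₀ (by norm_num) this
          _ = _ := by rw [pow_succ]; ring
      · push Not at h
        obtain ⟨i, v, hv, hvi⟩ := h
        have := deficit_succ_add_one_le (z := Function.update z m w) m i (v := v)
          (by rwa [mem_missableVertices, partialGraph_update z le_rfl, ← mem_missableVertices])
          (by simpa using hvi) (by rwa [deficit_update z le_rfl])
        rw [deficit_update z le_rfl, ← hu] at this
        rw [mul_zero, add_zero, ← div_eq_mul_inv, le_div_iff₀ (by norm_num), ← pow_succ]
        exact pow_le_pow_right₀ (by norm_num) this
    refine (Finset.expect_le_expect fun w _ => hpt w).trans ?_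
    rw [Finset.expect_add_distrib, Finset.expect_const Finset.univ_nonempty, ← Finset.mul_expect,
      expect_avoid m D hDsub]
    have hq : (1 - (D.card : ℝ) / (m.val + 1)) ^ 4 ≤ 0.84 ^ 4 := by
      have hp : (0 : ℝ) < m.val + 1 := by positivity
      have h1 : (D.card : ℝ) / (m.val + 1) ≤ 1 := (div_le_one hp).2 hDle
      have h2 : 0.16 ≤ (D.card : ℝ) / (m.val + 1) := by
        rw [le_div_iff₀ hp]
        exact hDc.le
      exact pow_le_pow_left₀ (by linarith) (by linarith) 4
    have hV : (0 : ℝ) < 1.005 ^ u := by positivity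
    calc (1.005 : ℝ) ^ u * (1.005)⁻¹ + (1.005 : ℝ) ^ u * (1.005 - (1.005)⁻¹) *
          (1 - (D.card : ℝ) / (m.val + 1)) ^ 4
        ≤ (1.005 : ℝ) ^ u * (1.005)⁻¹ + (1.005 : ℝ) ^ u * (1.005 - (1.005)⁻¹) * 0.84 ^ 4 := by
          gcongr
      _ = (1.005 : ℝ) ^ u * ((1.005)⁻¹ + (1.005 - (1.005)⁻¹) * 0.84 ^ 4) := by ring
      -- Since `0.84 ^ 4 < 0.498`, the factor is about `0.999991`.
      _ ≤ (1.005 : ℝ) ^ u * 0.999995 := by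
          gcongr
          norm_num
      _ ≤ _ := by linarith

open Classical in
/-- As long as the graph has been expanding since time `s`, the exponential moment of the deficit
stays bounded. -/
theorem expect_pow_deficit_indicator_le (s t : ℕ) (hst : s ≤ t) (ht : t + 1 ≤ n) :
    𝔼 z : Choices n 4, (if ∀ r, s ≤ r → r < t → IsExpanding z r then
        (1.005 : ℝ) ^ deficit z t else 0)
      ≤ 1.005 ^ (s + 1) + 201000 := by
  induction t, hst using Nat.le_induction with
  | base =>
    refine (Finset.expect_le_expect (g := fun _ => (1.005 : ℝ) ^ (s + 1)) fun z _ => ?_).trans ?_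
    · split_ifs
      · exact pow_le_pow_right₀ (by norm_num) (deficit_le z s)
      · positivity
    · rw [Finset.expect_const Finset.univ_nonempty]
      norm_num
  | succ t hst ih =>
    have ih := ih (by omega)
    let m : Fin (n - 1) := ⟨t, by omega⟩
    rw [expect_update m]
    have hpt : ∀ z : Choices n 4, 𝔼 w : Fin 4 → Fin (m.val + 1),
        (if ∀ r, s ≤ r → r < t + 1 → IsExpanding (Function.update z m w) r then
          (1.005 : ℝ) ^ deficit (Function.update z m w) (t + 1) else 0) ≤
        0.999995 * (if ∀ r, s ≤ r → r < t → IsExpanding z r then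
          (1.005 : ℝ) ^ deficit z t else 0) + 1.005 := by
      intro z
      -- Expansion up to time `t` does not depend on the choices of vertex `t + 1`, which are the
      -- ones resampled.
      have hiff : ∀ w : Fin 4 → Fin (m.val + 1),
          (∀ r, s ≤ r → r < t + 1 → IsExpanding (Function.update z m w) r) ↔
            ∀ r, s ≤ r → r < t + 1 → IsExpanding z r := fun w =>
        forall_congr' fun r => forall_congr' fun _ => forall_congr' fun hr =>
          isExpanding_update z (Nat.lt_succ_iff.1 hr) w
      simp only [hiff]
      by_cases h : ∀ r, s ≤ r → r < t + 1 → IsExpanding z r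
      · simp only [if_pos h]
        rw [if_pos fun r hr hrt => h r hr (by omega)]
        exact expect_pow_deficit_le m (h t hst (by omega))
      · simp only [if_neg h]
        rw [Finset.expect_const_zero]
        split_ifs <;> positivity
    refine (Finset.expect_le_expect fun z _ => hpt z).trans ?_
    rw [Finset.expect_add_distrib, Finset.expect_const Finset.univ_nonempty, ← Finset.mul_expect]
    have : (0 : ℝ) ≤ 1.005 ^ (s + 1) := by positivity
    -- `201000 = 1.005 / (1 - 0.999995)` is the fixed point of the recursion.
    linarith

end Drift

/-! ### Probability that two vertex sets are separated -/

/-- The bound `(a + b)! (m - a)! / (m! b!)` for the probability that, with one choice per vertex,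
there is no edge between a set of `a` vertices and the complement of its union with a disjoint set
of `b` vertices. -/
noncomputable def separationBound (m a b : ℕ) : ℝ :=
  ((a + b).factorial * (m - a).factorial : ℝ) / (m.factorial * b.factorial)

theorem separationBound_nonneg (m a b : ℕ) : 0 ≤ separationBound m a b := by
  unfold separationBound
  positivity

theorem separationBound_succ_left (m a b : ℕ) :
    separationBound (m + 1) (a + 1) b = separationBound m a b * ((a + b + 1) / (m + 1)) := by
  have h1 : a + 1 + b = (a + b) + 1 := by ring
  unfold separationBound
  rw [h1, Nat.add_sub_add_right, Nat.factorial_succ (a + b), Nat.factorial_succ m]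
  push_cast
  field_simp

theorem separationBound_succ {m a b : ℕ} (h : a ≤ m) :
    separationBound (m + 1) a b = separationBound m a b * ((m + 1 - a) / (m + 1)) := by
  obtain ⟨d, rfl⟩ := Nat.exists_eq_add_of_le h
  unfold separationBound
  have h1 : a + d + 1 - a = d + 1 := by omega
  have h2 : a + d - a = d := by omega
  rw [h1, h2, Nat.factorial_succ d, Nat.factorial_succ (a + d)]
  push_cast
  field_simp
  ring

theorem separationBound_succ_right {m a b : ℕ} (h : a ≤ m) :
    separationBound (m + 1) a (b + 1) =
      separationBound m a b * ((a + b + 1) * (m + 1 - a) / ((m + 1) * (b + 1))) := by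
  rw [separationBound_succ h]
  unfold separationBound
  rw [← add_assoc, Nat.factorial_succ (a + b), Nat.factorial_succ b]
  push_cast
  field_simp

/-- The choices `x` of vertex `j + 1` that create no edge between `A` and the complement of
`A ∪ B`. -/
def separatingChoices (A B : Finset ℕ) (j : ℕ) : Finset ℕ :=
  (Finset.range (j + 1)).filter fun x =>
    (j + 1 ∈ A → x ∈ A ∪ B) ∧ (j + 1 ∉ A → j + 1 ∉ B → x ∉ A)

theorem card_range_succ_inter (A : Finset ℕ) (t : ℕ) :
    (Finset.range (t + 1) ∩ A).card =
      (Finset.range t ∩ A).card + if t ∈ A then 1 else 0 := by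
  rw [Finset.range_add_one]
  split_ifs with h
  · rw [Finset.insert_inter_of_mem h, Finset.card_insert_of_notMem (by simp)]
  · rw [Finset.insert_inter_of_notMem h, add_zero]

/-- Induction on time: whether the new vertex lies in `A`, in `B` or in neither, its factor is at
most the ratio of consecutive bounds. For `B`, with `m = t + 1`, this reduces to `a * (m - a - b) ≥
0`. -/
theorem prod_separatingChoices_le {A B : Finset ℕ} (hAB : Disjoint A B) (t : ℕ) :
    ∏ j ∈ Finset.range t, ((separatingChoices A B j).card : ℝ) / (j + 1) ≤
      separationBound (t + 1) (Finset.range (t + 1) ∩ A).card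
        (Finset.range (t + 1) ∩ B).card := by
  induction t with
  | zero =>
    have hA := card_range_succ_inter A 0
    have hB := card_range_succ_inter B 0
    rw [hA, hB]
    by_cases h : 0 ∈ A
    · have h' : 0 ∉ B := Finset.disjoint_left.1 hAB h
      simp [h, h', separationBound]
    · by_cases h' : 0 ∈ B <;> simp [h, h', separationBound]
  | succ t ih =>
    set a := (Finset.range (t + 1) ∩ A).card with ha
    set b := (Finset.range (t + 1) ∩ B).card with hb
    have hab : a + b ≤ t + 1 := by
      rw [ha, hb, ← Finset.card_union_of_disjoint
        (hAB.mono Finset.inter_subset_right Finset.inter_subset_right)]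
      calc _ ≤ (Finset.range (t + 1)).card :=
            Finset.card_le_card (Finset.union_subset Finset.inter_subset_left
              Finset.inter_subset_left)
        _ = t + 1 := Finset.card_range _
    have habR : (a : ℝ) + b ≤ t + 1 := by exact_mod_cast hab
    rw [Finset.prod_range_succ, card_range_succ_inter A (t + 1), card_range_succ_inter B (t + 1),
      ← ha, ← hb]
    have hS := separationBound_nonneg (t + 1) a b
    have ht0 : (0 : ℝ) < t + 1 := by positivity
    by_cases hA : t + 1 ∈ A
    · have hB : t + 1 ∉ B := Finset.disjoint_left.1 hAB hA
      rw [if_pos hA, if_neg hB, add_zero, separationBound_succ_left]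
      have hc : (separatingChoices A B t).card = a + b := by
        rw [ha, hb, ← Finset.card_union_of_disjoint
          (hAB.mono Finset.inter_subset_right Finset.inter_subset_right),
          ← Finset.inter_union_distrib_left]
        congr 1
        ext x
        simp [separatingChoices, hA]
      rw [hc]
      refine mul_le_mul ih ?_ (by positivity) hS
      rw [div_le_div_iff₀ ht0 (by positivity)]
      push_cast
      nlinarith
    · by_cases hB : t + 1 ∈ B
      · rw [if_neg hA, if_pos hB, add_zero, separationBound_succ_right (by omega)]
        refine mul_le_mul ih ?_ (by positivity) hS
        have hc : (separatingChoices A B t).card ≤ t + 1 :=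
          (Finset.card_filter_le _ _).trans (Finset.card_range _).le
        calc ((separatingChoices A B t).card : ℝ) / (t + 1) ≤ 1 := by
              rw [div_le_one ht0]
              exact_mod_cast hc
          _ ≤ _ := by
              rw [one_le_div (by positivity)]
              push_cast
              nlinarith [Nat.cast_nonneg (α := ℝ) a]
      · rw [if_neg hA, if_neg hB, add_zero, add_zero, separationBound_succ (by omega)]
        refine mul_le_mul ih ?_ (by positivity) hS
        have hc : (separatingChoices A B t).card + a = t + 1 := by
          have h1 := Finset.card_sdiff_add_card_inter (Finset.range (t + 1)) A
          rw [Finset.card_range, ← ha] at h1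
          rw [← h1]
          congr 2
          ext x
          simp [separatingChoices, hA, hB]
        have hcR : ((separatingChoices A B t).card : ℝ) = t + 1 - a := by
          rw [eq_sub_iff_add_eq]
          exact_mod_cast hc
        rw [hcR, div_le_div_iff₀ ht0 (by positivity)]
        push_cast
        nlinarith [Nat.cast_nonneg (α := ℝ) a]

theorem expect_indicator_forall {ι : Type*} [Fintype ι] [DecidableEq ι] {β : ι → Type*}
    [∀ i, Fintype (β i)] [∀ i, Nonempty (β i)] (S : ∀ i, Finset (β i))
    [∀ z : ∀ i, β i, Decidable (∀ i, z i ∈ S i)] :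
    𝔼 z : ∀ i, β i, (if ∀ i, z i ∈ S i then (1 : ℝ) else 0)
      = ∏ i, ((S i).card : ℝ) / Fintype.card (β i) := by
  rw [Fintype.expect_eq_sum_div_card, Finset.sum_boole]
  have : (Finset.univ.filter fun z : ∀ i, β i => ∀ i, z i ∈ S i) = Fintype.piFinset S := by
    ext z; simp
  rw [this, Fintype.card_piFinset, Fintype.card_pi, Finset.prod_div_distrib]
  push_cast
  rfl

/-- The event that at time `t` there is no edge between `A` and the complement of `A ∪ B`. -/
def IsSeparated {n k : ℕ} (z : Choices n k) (t : ℕ) (A B : Finset ℕ) : Prop :=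
  ∀ j : Fin (n - 1), j.val < t → ∀ i, (z j i).val ∈ separatingChoices A B j.val

instance {n k : ℕ} (z : Choices n k) (t : ℕ) (A B : Finset ℕ) :
    Decidable (IsSeparated z t A B) := by
  unfold IsSeparated
  infer_instance

/-- Independence makes this a product over vertices; the `k` choices of each contribute equal
factors, and vertices arriving after time `t` contribute `1`. -/
theorem expect_isSeparated_le {n k t : ℕ} (ht : t + 1 ≤ n) {A B : Finset ℕ} (hAB : Disjoint A B) :
    𝔼 z : Choices n k, (if IsSeparated z t A B then (1 : ℝ) else 0) ≤
      separationBound (t + 1) (Finset.range (t + 1) ∩ A).card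
        (Finset.range (t + 1) ∩ B).card ^ k := by
  let T : ∀ j : Fin (n - 1), Finset (Fin (j.val + 1)) := fun j =>
    Finset.univ.filter fun x => j.val < t → x.val ∈ separatingChoices A B j.val
  let S : ∀ j : Fin (n - 1), Finset (Fin k → Fin (j.val + 1)) := fun j =>
    Fintype.piFinset fun _ => T j
  have hT : ∀ j : Fin (n - 1), j.val < t → (T j).card = (separatingChoices A B j.val).card := by
    intro j hj
    rw [← Finset.card_map Fin.valEmbedding]
    congr 1
    ext x
    simp only [T, Finset.mem_map, Finset.mem_filter, Finset.mem_univ, true_and,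
      Fin.valEmbedding_apply]
    constructor
    · rintro ⟨y, hy, rfl⟩
      exact hy hj
    · intro hx
      have : x < j.val + 1 := Finset.mem_range.1 (Finset.mem_filter.1 hx).1
      exact ⟨⟨x, this⟩, fun _ => hx, rfl⟩
  have hT' : ∀ j : Fin (n - 1), ¬ j.val < t → (T j).card = j.val + 1 := by
    intro j hj
    simp [T, hj]
  have hiff : ∀ z : Choices n k, IsSeparated z t A B ↔ ∀ j, z j ∈ S j := by
    intro z
    simp only [IsSeparated, S, T, Fintype.mem_piFinset, Finset.mem_filter, Finset.mem_univ,
      true_and]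
    exact forall_congr' fun j => forall_comm
  have heq : 𝔼 z : Choices n k, (if IsSeparated z t A B then (1 : ℝ) else 0) =
      𝔼 z : Choices n k, (if ∀ j, z j ∈ S j then (1 : ℝ) else 0) :=
    Finset.expect_congr rfl fun z _ => if_congr (hiff z) rfl rfl
  refine (heq.trans (expect_indicator_forall S)).trans_le ?_
  have hprod : ∏ j : Fin (n - 1), ((S j).card : ℝ) / Fintype.card (Fin k → Fin (j.val + 1))
      = (∏ j ∈ Finset.range t, ((separatingChoices A B j).card : ℝ) / (j + 1)) ^ k := by
    rw [← Finset.prod_pow]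
    have hsub : Finset.range t ⊆ Finset.range (n - 1) := Finset.range_mono (by omega)
    have h1 : ∏ j ∈ Finset.range t, (((separatingChoices A B j).card : ℝ) / (j + 1)) ^ k
        = ∏ j ∈ Finset.range (n - 1),
          (if j < t then (((separatingChoices A B j).card : ℝ) / (j + 1)) ^ k else 1) := by
      rw [← Finset.prod_subset hsub]
      · refine Finset.prod_congr rfl fun j hj => ?_
        rw [if_pos (Finset.mem_range.1 hj)]
      · intro j _ hj
        rw [if_neg (by simpa using hj)]
    rw [h1, ← Fin.prod_univ_eq_prod_range
      (fun j => if j < t then (((separatingChoices A B j).card : ℝ) / (j + 1)) ^ k else 1) (n - 1)]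
    refine Finset.prod_congr rfl fun j _ => ?_
    have hc : (S j).card = (T j).card ^ k := by simp [S]
    rw [hc]
    split_ifs with hj
    · rw [hT j hj]
      simp [div_pow]
    · rw [hT' j hj]
      have : ((j.val : ℝ) + 1) ^ k ≠ 0 := by positivity
      simp [div_self this]
  rw [hprod]
  refine pow_le_pow_left₀ (Finset.prod_nonneg fun j _ => by positivity) ?_ k
  exact prod_separatingChoices_le hAB t

/-- A set with few external neighbours is separated from the complement of its closed
neighbourhood. -/
theorem exists_isSeparated {n k t : ℕ} {z : Choices n k} (hz : ¬ IsExpanding z t) :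
    ∃ A B : Finset ℕ, A ⊆ Finset.range (t + 1) ∧ B ⊆ Finset.range (t + 1) \ A ∧ A.Nonempty ∧
      (A.card : ℝ) ≤ 0.16 * (t + 1) ∧ B.card < A.card ∧ IsSeparated z t A B := by
  classical
  unfold IsExpanding at hz
  push Not at hz
  obtain ⟨A, hA, hne, hcard, hlt⟩ := hz
  set B := externalNeighbors (partialGraph z t) A with hB
  have hmemB : ∀ y, y ∈ B ↔ y ∉ A ∧ ∃ x ∈ A, (partialGraph z t).Adj x y := by
    intro y
    simp [hB, externalNeighbors]
  have hact : ∀ v : Fin n, v ∈ activeVertices n t → v.val < t + 1 := fun v hv =>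
    Nat.lt_succ_of_le (Finset.mem_filter.1 hv).2
  refine ⟨A.map Fin.valEmbedding, B.map Fin.valEmbedding, ?_, ?_, hne.map, ?_, ?_, ?_⟩
  · intro x hx
    obtain ⟨v, hv, rfl⟩ := Finset.mem_map.1 hx
    exact Finset.mem_range.2 (hact v (hA hv))
  · intro x hx
    obtain ⟨v, hv, rfl⟩ := Finset.mem_map.1 hx
    obtain ⟨hvA, u, hu, huv⟩ := (hmemB v).1 hv
    refine Finset.mem_sdiff.2 ⟨Finset.mem_range.2 (hact v (partialGraph_adj_mem huv.symm)), ?_⟩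
    rwa [Finset.mem_map' Fin.valEmbedding]
  · rwa [Finset.card_map]
  · rwa [Finset.card_map, Finset.card_map]
  · intro j hj i
    have hjn := j.isLt
    have hx := (z j i).isLt
    set u : Fin n := ⟨(z j i).val, by omega⟩ with hu
    set v : Fin n := ⟨j.val + 1, by omega⟩ with hv
    have hadj : (partialGraph z t).Adj u v := by
      refine ⟨fun e => ?_, Or.inl ⟨j, i, hj, rfl, rfl⟩⟩
      have := congrArg Fin.val e
      simp only [hu, hv] at this
      omega
    have mem_iff : ∀ (C : Finset (Fin n)) (w : Fin n), w.val ∈ C.map Fin.valEmbedding ↔ w ∈ C :=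
      fun C w => Finset.mem_map' Fin.valEmbedding
    have huA := mem_iff A u
    have huB := mem_iff B u
    have hvA := mem_iff A v
    have hvB := mem_iff B v
    simp only [hu, hv] at huA huB hvA hvB
    rw [separatingChoices, Finset.mem_filter, Finset.mem_range, Finset.mem_union, huA, huB, hvA,
      hvB]
    refine ⟨hx, fun h => ?_, fun h1 h2 h3 => ?_⟩
    · by_cases hc : u ∈ A
      · exact Or.inl hc
      · exact Or.inr ((hmemB _).2 ⟨hc, v, h, hadj.symm⟩)
    · exact h2 ((hmemB _).2 ⟨h1, u, h3, hadj⟩)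

/-! ### Numerical estimates for the union bound -/

section Estimates

theorem descFactorial_mul_pow_le {m a : ℕ} (h : 2 * a ≤ m) :
    (m - a).descFactorial a * m ^ (2 * a) ≤ m.descFactorial a ^ 3 := by
  -- Factorwise, `(m - a - i) * m ≤ (m - i) * (m - a)`, with difference `a * i`.
  have h1 : (m - a).descFactorial a * m ^ a ≤ m.descFactorial a * (m - a) ^ a := by
    rw [Nat.descFactorial_eq_prod_range, Nat.descFactorial_eq_prod_range,
      Finset.pow_eq_prod_const m a, Finset.pow_eq_prod_const (m - a) a,
      ← Finset.prod_mul_distrib, ← Finset.prod_mul_distrib]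
    refine Finset.prod_le_prod' fun i hi => ?_
    have hi := Finset.mem_range.1 hi
    obtain ⟨d, rfl⟩ := Nat.exists_eq_add_of_le (show a + i ≤ m by omega)
    have e1 : a + i + d - a - i = d := by omega
    have e2 : a + i + d - i = a + d := by omega
    have e3 : a + i + d - a = i + d := by omega
    rw [e1, e2, e3]
    nlinarith [Nat.zero_le (a * i)]
  -- Reversing one copy of the product pairs `m - i` with `m - (a - 1 - i)`; each such product is at
  -- least `(m - a) * m`.
  have h2 : (m - a) ^ a * m ^ a ≤ m.descFactorial a ^ 2 := by
    have hr : m.descFactorial a = ∏ i ∈ Finset.range a, (m - (a - 1 - i)) := by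
      rw [Nat.descFactorial_eq_prod_range, Finset.prod_range_reflect (fun i => m - i)]
    rw [sq]
    nth_rewrite 2 [hr]
    rw [Nat.descFactorial_eq_prod_range, ← Finset.prod_mul_distrib, ← mul_pow, Finset.pow_eq_prod_const _ a]
    refine Finset.prod_le_prod' fun i hi => ?_
    have hi := Finset.mem_range.1 hi
    obtain ⟨c, rfl⟩ := Nat.exists_eq_add_of_le (show i + 1 ≤ a by omega)
    obtain ⟨d, rfl⟩ := Nat.exists_eq_add_of_le (show i + 1 + c ≤ m by omega)
    have e1 : i + 1 + c + d - (i + 1 + c) = d := by omega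
    have e2 : i + 1 + c + d - (i + 1 + c - 1 - i) = i + 1 + d := by omega
    have e3 : i + 1 + c + d - i = 1 + c + d := by omega
    rw [e1, e2, e3]
    nlinarith [Nat.zero_le (i * c)]
  calc (m - a).descFactorial a * m ^ (2 * a)
      = (m - a).descFactorial a * m ^ a * m ^ a := by ring
    _ ≤ m.descFactorial a * (m - a) ^ a * m ^ a := Nat.mul_le_mul_right _ h1
    _ = m.descFactorial a * ((m - a) ^ a * m ^ a) := by ring
    _ ≤ m.descFactorial a * m.descFactorial a ^ 2 := Nat.mul_le_mul_left _ h2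
    _ = _ := by ring

theorem choose_mul_pow_le {m a : ℕ} (h : 2 * a ≤ m) :
    (m - a).choose a * m ^ (2 * a) ≤ a.factorial ^ 2 * m.choose a ^ 3 := by
  have h1 := descFactorial_mul_pow_le h
  rw [Nat.descFactorial_eq_factorial_mul_choose, Nat.descFactorial_eq_factorial_mul_choose] at h1
  refine Nat.le_of_mul_le_mul_left (c := a.factorial) ?_ a.factorial_pos
  calc _ = a.factorial * (m - a).choose a * m ^ (2 * a) := by ring
    _ ≤ _ := h1
    _ = _ := by ring

theorem choose_le_choose_of_le_half {m a b : ℕ} (hba : b ≤ a) (ha : a ≤ m / 2) :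
    m.choose b ≤ m.choose a := by
  induction a, hba using Nat.le_induction with
  | base => exact le_rfl
  | succ a _ ih => exact (ih (by omega)).trans (Nat.choose_le_succ_of_lt_half_left (by omega))

theorem separationBound_eq {m a b : ℕ} (h : a ≤ m) :
    separationBound m a b = ((a + b).choose a : ℝ) / m.choose a := by
  rw [separationBound, Nat.cast_choose ℝ h, Nat.cast_add_choose ℝ]
  field_simp

/-- The expected number of separated pairs of sets of sizes `a` and `b < a`. -/
theorem choose_mul_separationBound_le {m a b : ℕ} (hba : b < a) (h : 3 * a ≤ m) :
    (m.choose a * (m - a).choose b : ℝ) * separationBound m a b ^ 4 ≤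
      (16 ^ a * a.factorial / m ^ a : ℝ) ^ 2 := by
  rw [separationBound_eq (by omega)]
  have hc : (0 : ℝ) < m.choose a := by exact_mod_cast Nat.choose_pos (by omega)
  have hm : (0 : ℝ) < m := by exact_mod_cast (show 0 < m by omega)
  -- Binomials increase up to the middle, and `3 * a ≤ m` puts `a` below half of `m - a`.
  have h1 : ((m - a).choose b : ℝ) ≤ (m - a).choose a := by
    exact_mod_cast choose_le_choose_of_le_half hba.le (by omega)
  have h2 : ((a + b).choose a : ℝ) ≤ 4 ^ a := by
    have : (a + b).choose a ≤ 4 ^ a :=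
      calc (a + b).choose a ≤ 2 ^ (a + b) := Nat.choose_le_two_pow _ _
        _ ≤ 2 ^ (2 * a) := Nat.pow_le_pow_right (by norm_num) (by omega)
        _ = 4 ^ a := by rw [pow_mul]; norm_num
    exact_mod_cast this
  have h3 : ((m - a).choose a : ℝ) * m ^ (2 * a) ≤ a.factorial ^ 2 * m.choose a ^ 3 := by
    exact_mod_cast choose_mul_pow_le (show 2 * a ≤ m by omega)
  calc (m.choose a * (m - a).choose b : ℝ) * (((a + b).choose a : ℝ) / m.choose a) ^ 4
      ≤ (m.choose a * (m - a).choose a : ℝ) * ((4 : ℝ) ^ a / m.choose a) ^ 4 := by gcongr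
    _ = (16 ^ a) ^ 2 * (((m - a).choose a : ℝ) / m.choose a ^ 3) := by
        have : ((4 : ℝ) ^ a) ^ 4 = (16 ^ a) ^ 2 := by
          rw [← pow_mul, ← pow_mul, mul_comm a 4, mul_comm a 2, pow_mul, pow_mul]; norm_num
        rw [div_pow, this]
        field_simp
    _ ≤ (16 ^ a) ^ 2 * ((a.factorial : ℝ) ^ 2 / m ^ (2 * a)) := by
        refine mul_le_mul_of_nonneg_left ?_ (by positivity)
        rw [div_le_div_iff₀ (by positivity) (by positivity)]
        exact h3
    _ = _ := by
        rw [div_pow, mul_pow, ← pow_mul (m : ℝ), mul_comm 2 a]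
        ring

/-- A weak Stirling bound, by induction from `(1 - 1/(a+1))^(a+1) ≤ 1/e`. -/
theorem factorial_le_mul_div_exp_pow {a : ℕ} (ha : 1 ≤ a) :
    (a.factorial : ℝ) ≤ Real.exp 1 * a * (a / Real.exp 1) ^ a := by
  induction a, ha using Nat.le_induction with
  | base =>
    have := Real.exp_pos 1
    simp
  | succ a ha ih =>
    have ha0 : (0 : ℝ) < a := by exact_mod_cast ha
    have he := Real.exp_pos 1
    have h1 : Real.exp 1 * (a : ℝ) ^ (a + 1) ≤ ((a : ℝ) + 1) ^ (a + 1) := by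
      have h2 : (a : ℝ) / (a + 1) ≤ Real.exp (-(1 / (a + 1))) := by
        have := Real.one_sub_le_exp_neg (1 / ((a : ℝ) + 1))
        refine le_trans (le_of_eq ?_) this
        field_simp
        ring
      have h3 : ((a : ℝ) / (a + 1)) ^ (a + 1) ≤ Real.exp (-1) := by
        refine (pow_le_pow_left₀ (by positivity) h2 (a + 1)).trans (le_of_eq ?_)
        rw [← Real.exp_nat_mul]
        congr 1
        push_cast
        field_simp
      rw [div_pow, Real.exp_neg, div_le_iff₀ (by positivity)] at h3
      calc Real.exp 1 * (a : ℝ) ^ (a + 1)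
          ≤ Real.exp 1 * ((Real.exp 1)⁻¹ * ((a : ℝ) + 1) ^ (a + 1)) := by gcongr
        _ = _ := by field_simp
    rw [Nat.factorial_succ]
    push_cast
    calc ((a : ℝ) + 1) * a.factorial
        ≤ (a + 1) * (Real.exp 1 * a * (a / Real.exp 1) ^ a) := by gcongr
      _ = (a + 1) / Real.exp 1 ^ a * (Real.exp 1 * (a : ℝ) ^ (a + 1)) := by
          rw [div_pow]; ring
      _ ≤ (a + 1) / Real.exp 1 ^ a * ((a : ℝ) + 1) ^ (a + 1) := by gcongr
      _ = _ := by
          rw [div_pow, pow_succ (Real.exp 1)]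
          field_simp

theorem mul_sq_le_geometric {m a : ℕ} (ha : 1 ≤ a) (hm : (a : ℝ) ≤ 0.16 * m) :
    (a : ℝ) * (16 ^ a * a.factorial / m ^ a : ℝ) ^ 2 ≤
      400 / m ^ 2 * ((a : ℝ) ^ 5 * 0.9025 ^ a) := by
  have ha0 : (1 : ℝ) ≤ a := by exact_mod_cast ha
  have hm0 : (0 : ℝ) < m := by linarith
  have he : (2.7 : ℝ) < Real.exp 1 := by linarith [Real.exp_one_gt_d9]
  have he' : Real.exp 1 < 2.72 := by linarith [Real.exp_one_lt_d9]
  have hx0 : 0 ≤ 16 * (a : ℝ) / (Real.exp 1 * m) := by positivity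
  set x := 16 * (a : ℝ) / (Real.exp 1 * m) with hx
  -- This is where `0.16` is needed: `16 * 0.16 / e < 0.95`, and `0.9025 = 0.95 ^ 2`.
  have hx1 : x ≤ 0.95 := by
    rw [hx, div_le_iff₀ (by positivity)]
    nlinarith
  have hx2 : x ≤ 6 * a / m := by
    rw [hx, div_le_div_iff₀ (by positivity) hm0]
    have : 16 ≤ 6 * Real.exp 1 := by linarith
    have h' := mul_le_mul_of_nonneg_right this (show (0 : ℝ) ≤ a * m by positivity)
    linarith
  have hv : (16 ^ a * a.factorial / m ^ a : ℝ) ≤ Real.exp 1 * a * x ^ a := by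
    calc (16 ^ a * a.factorial / m ^ a : ℝ)
        ≤ 16 ^ a * (Real.exp 1 * a * (a / Real.exp 1) ^ a) / m ^ a := by
          gcongr
          exact factorial_le_mul_div_exp_pow ha
      _ = _ := by
          rw [hx, div_pow, div_pow, mul_pow, mul_pow]
          field_simp
  -- One factor `x ^ 2` is set aside to yield `1 / m ^ 2`; the others give geometric decay.
  have hxa : (x ^ a) ^ 2 ≤ (6 * a / m) ^ 2 * (0.9025 ^ a / 0.9025) := by
    obtain ⟨c, rfl⟩ := Nat.exists_eq_add_of_le' ha
    calc (x ^ (c + 1)) ^ 2 = x ^ 2 * (x ^ 2) ^ c := by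
          rw [← pow_mul, ← pow_mul, ← pow_add]
          congr 1
          omega
      _ ≤ (6 * ((c + 1 : ℕ) : ℝ) / m) ^ 2 * (0.9025 : ℝ) ^ c := by
          gcongr
          calc x ^ 2 ≤ 0.95 ^ 2 := by gcongr
            _ = 0.9025 := by norm_num
      _ = _ := by
          rw [pow_succ (0.9025 : ℝ) c, mul_div_assoc ((0.9025 : ℝ) ^ c), div_self (by norm_num),
            mul_one]
  calc (a : ℝ) * (16 ^ a * a.factorial / m ^ a : ℝ) ^ 2
      ≤ a * (Real.exp 1 * a * x ^ a) ^ 2 := by gcongr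
    _ = a * (Real.exp 1 ^ 2 * a ^ 2) * (x ^ a) ^ 2 := by ring
    _ ≤ a * (2.72 ^ 2 * a ^ 2) * ((6 * a / m) ^ 2 * (0.9025 ^ a / 0.9025)) := by gcongr
    _ = (2.72 ^ 2 * 36 / 0.9025) / m ^ 2 * ((a : ℝ) ^ 5 * 0.9025 ^ a) := by
        field_simp
        norm_num
    _ ≤ _ := by
        gcongr
        norm_num

end Estimates

/-! ### Expansion holds with high probability -/

open Classical in
/-- The probability of failing to expand at time `t` is `O(1 / t ^ 2)`. -/
theorem exists_expect_not_isExpanding_le :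
    ∃ C : ℝ, 0 ≤ C ∧ ∀ n t : ℕ, t + 1 ≤ n →
      𝔼 z : Choices n 4, (if IsExpanding z t then (0 : ℝ) else 1) ≤ C / (t + 1) ^ 2 := by
  have hsum : Summable fun a : ℕ => (a : ℝ) ^ 5 * 0.9025 ^ a :=
    summable_pow_mul_geometric_of_norm_lt_one 5 (by norm_num)
  have hnn : ∀ a : ℕ, 0 ≤ (a : ℝ) ^ 5 * 0.9025 ^ a := fun a => by positivity
  refine ⟨400 * ∑' a : ℕ, (a : ℝ) ^ 5 * 0.9025 ^ a, mul_nonneg (by norm_num) (tsum_nonneg hnn),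
    fun n t ht => ?_⟩
  set m := t + 1 with hm
  have hmR : (m : ℝ) = t + 1 := by rw [hm]; push_cast; rfl
  set I : Finset ℕ := (Finset.Icc 1 m).filter fun a => (a : ℝ) ≤ 0.16 * m with hI
  -- Union bound over `A` of size `a` and its candidate neighbourhood `B` of size `b < a`.
  have hpt : ∀ z : Choices n 4, (if IsExpanding z t then (0 : ℝ) else 1) ≤
      ∑ a ∈ I, ∑ b ∈ Finset.range a, ∑ A ∈ (Finset.range m).powersetCard a,
        ∑ B ∈ (Finset.range m \ A).powersetCard b, if IsSeparated z t A B then (1 : ℝ) else 0 := by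
    intro z
    have nn1 : ∀ (b : ℕ) (A : Finset ℕ), (0 : ℝ) ≤ ∑ B ∈ (Finset.range m \ A).powersetCard b,
        if IsSeparated z t A B then (1 : ℝ) else 0 := fun b A =>
      Finset.sum_nonneg fun B _ => by split_ifs <;> norm_num
    have nn2 : ∀ a b : ℕ, (0 : ℝ) ≤ ∑ A ∈ (Finset.range m).powersetCard a,
        ∑ B ∈ (Finset.range m \ A).powersetCard b,
          if IsSeparated z t A B then (1 : ℝ) else 0 := fun a b =>
      Finset.sum_nonneg fun A _ => nn1 b A
    have nn3 : ∀ a : ℕ, (0 : ℝ) ≤ ∑ b ∈ Finset.range a, ∑ A ∈ (Finset.range m).powersetCard a,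
        ∑ B ∈ (Finset.range m \ A).powersetCard b,
          if IsSeparated z t A B then (1 : ℝ) else 0 := fun a =>
      Finset.sum_nonneg fun b _ => nn2 a b
    split_ifs with h
    · exact Finset.sum_nonneg fun a _ => nn3 a
    · obtain ⟨A, B, hA, hB, hne, hAc, hBA, hs⟩ := exists_isSeparated h
      have hAI : A.card ∈ I := by
        refine Finset.mem_filter.2 ⟨Finset.mem_Icc.2 ⟨hne.card_pos, ?_⟩, by rw [hmR]; exact hAc⟩
        simpa using Finset.card_le_card hA
      refine le_trans ?_ (Finset.single_le_sum (fun a _ => nn3 a) hAI)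
      refine le_trans ?_ (Finset.single_le_sum (fun b _ => nn2 A.card b)
        (Finset.mem_range.2 hBA))
      refine le_trans ?_ (Finset.single_le_sum (fun A' _ => nn1 B.card A')
        (Finset.mem_powersetCard.2 ⟨hA, rfl⟩))
      refine le_trans ?_ (Finset.single_le_sum (f := fun B' =>
        if IsSeparated z t A B' then (1 : ℝ) else 0)
        (fun B' _ => by split_ifs <;> norm_num) (Finset.mem_powersetCard.2 ⟨hB, rfl⟩))
      simp only [if_pos hs]
      exact le_rfl
  refine (Finset.expect_le_expect fun z _ => hpt z).trans ?_
  rw [Finset.expect_sum_comm]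
  have hterm : ∀ a ∈ I, 𝔼 z : Choices n 4, ∑ b ∈ Finset.range a,
      ∑ A ∈ (Finset.range m).powersetCard a, ∑ B ∈ (Finset.range m \ A).powersetCard b,
        (if IsSeparated z t A B then (1 : ℝ) else 0) ≤
      400 / m ^ 2 * ((a : ℝ) ^ 5 * 0.9025 ^ a) := by
    intro a ha
    obtain ⟨ha1, ham⟩ := Finset.mem_filter.1 ha
    have ha1 := (Finset.mem_Icc.1 ha1).1
    have h3a : 3 * a ≤ m := by
      have : (3 * a : ℝ) ≤ m := by
        have : (0 : ℝ) ≤ m := by positivity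
        linarith
      exact_mod_cast this
    refine le_trans ?_ (mul_sq_le_geometric ha1 ham)
    rw [Finset.expect_sum_comm]
    have hb : ∀ b ∈ Finset.range a, 𝔼 z : Choices n 4,
        ∑ A ∈ (Finset.range m).powersetCard a, ∑ B ∈ (Finset.range m \ A).powersetCard b,
          (if IsSeparated z t A B then (1 : ℝ) else 0) ≤
        (16 ^ a * a.factorial / m ^ a : ℝ) ^ 2 := by
      intro b hb
      refine le_trans ?_ (choose_mul_separationBound_le (Finset.mem_range.1 hb) h3a)
      rw [Finset.expect_sum_comm]
      have hA : ∀ A ∈ (Finset.range m).powersetCard a, 𝔼 z : Choices n 4,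
          ∑ B ∈ (Finset.range m \ A).powersetCard b,
            (if IsSeparated z t A B then (1 : ℝ) else 0) ≤
          (m - a).choose b * separationBound m a b ^ 4 := by
        intro A hA
        obtain ⟨hAs, hAc⟩ := Finset.mem_powersetCard.1 hA
        rw [Finset.expect_sum_comm]
        have hB : ∀ B ∈ (Finset.range m \ A).powersetCard b, 𝔼 z : Choices n 4,
            (if IsSeparated z t A B then (1 : ℝ) else 0) ≤ separationBound m a b ^ 4 := by
          intro B hB
          obtain ⟨hBs, hBc⟩ := Finset.mem_powersetCard.1 hB
          have hdis : Disjoint A B := (Finset.disjoint_sdiff).mono_right hBs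
          have := expect_isSeparated_le (k := 4) ht hdis
          rwa [Finset.inter_eq_right.2 hAs, Finset.inter_eq_right.2
            (hBs.trans Finset.sdiff_subset), hAc, hBc] at this
        refine (Finset.sum_le_card_nsmul _ _ _ hB).trans (le_of_eq ?_)
        rw [Finset.card_powersetCard, Finset.card_sdiff_of_subset hAs, Finset.card_range, hAc,
          nsmul_eq_mul]
      refine (Finset.sum_le_card_nsmul _ _ _ hA).trans (le_of_eq ?_)
      rw [Finset.card_powersetCard, Finset.card_range, nsmul_eq_mul, mul_assoc]
    refine (Finset.sum_le_card_nsmul _ _ _ hb).trans (le_of_eq ?_)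
    rw [Finset.card_range, nsmul_eq_mul]
  refine (Finset.sum_le_sum hterm).trans ?_
  rw [← Finset.mul_sum, ← hmR, mul_div_right_comm]
  gcongr
  exact hsum.sum_le_tsum I fun a _ => hnn a

/-! ### Tail bound and transfer to the measure -/

open Classical in
theorem choiceMeasure_apply {n k : ℕ} (S : Set (Choices n k)) :
    choiceMeasure n k S =
      ENNReal.ofReal (𝔼 z : Choices n k, if z ∈ S then (1 : ℝ) else 0) := by
  have hsing : ∀ z : Choices n k, choiceMeasure n k {z} =
      ENNReal.ofReal (Fintype.card (Choices n k) : ℝ)⁻¹ := by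
    intro z
    simp only [choiceMeasure, Measure.pi_singleton]
    have h1 : ∀ j : Fin (n - 1), ∀ x : Fin (j.val + 1),
        (PMF.uniformOfFintype (Fin (j.val + 1))).toMeasure {x} = ((j.val + 1 : ℕ) : ENNReal)⁻¹ := by
      intro j x
      rw [PMF.toMeasure_apply_singleton _ _ (measurableSet_singleton x),
        PMF.uniformOfFintype_apply, Fintype.card_fin]
    simp only [h1, Finset.prod_const, Finset.card_univ, Fintype.card_fin]
    rw [ENNReal.ofReal_inv_of_pos (by exact_mod_cast Fintype.card_pos), ENNReal.ofReal_natCast,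
      Fintype.card_pi]
    simp only [Fintype.card_pi, Fintype.card_fin, Finset.prod_const, Finset.card_univ]
    rw [Nat.cast_prod, ENNReal.prod_inv_distrib]
    · refine Finset.prod_congr rfl fun j _ => ?_
      rw [Nat.cast_pow, ENNReal.inv_pow]
    · intro i _ j _ _
      left
      simp
  have hS : S = ((Finset.univ.filter (· ∈ S) : Finset (Choices n k)) : Set (Choices n k)) := by
    ext z; simp
  conv_lhs => rw [hS]
  rw [← sum_measure_singleton]
  simp only [hsing]
  rw [Finset.sum_const, Fintype.expect_eq_sum_div_card, Finset.sum_boole, nsmul_eq_mul,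
    div_eq_mul_inv, ENNReal.ofReal_mul (Nat.cast_nonneg _), ENNReal.ofReal_natCast]

theorem exists_matching_of_deficit_lt {n k : ℕ} (hn : 1 ≤ n) (z : Choices n k) {c : ℝ}
    (h : (deficit z (n - 1) : ℝ) < c) :
    ∃ M : (graph z).Subgraph, M.IsMatching ∧ ((M.vertsᶜ).ncard : ℝ) < c := by
  obtain ⟨σ, hσ⟩ := exists_isMaxMatchingPerm (graph z)
  obtain ⟨M, hM, hv⟩ := hσ.exists_subgraph
  refine ⟨M, hM, ?_⟩
  have hc : (M.vertsᶜ).ncard = deficit z (n - 1) := by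
    rw [hv, ← Finset.coe_compl, Set.ncard_coe_finset, Finset.card_compl, Fintype.card_fin,
      hσ.card_support, deficit, partialGraph_sub_one, Nat.sub_add_cancel hn]
  rwa [hc]

/-- Telescoping, from `1/(t+1)^2 ≤ 1/t - 1/(t+1)`. -/
theorem sum_Ico_inv_sq_le {s t : ℕ} (hs : 1 ≤ s) (hst : s ≤ t) :
    ∑ r ∈ Finset.Ico s t, 1 / ((r : ℝ) + 1) ^ 2 ≤ 1 / (s : ℝ) - 1 / t := by
  induction t, hst using Nat.le_induction with
  | base => simp
  | succ t hst ih =>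
    rw [Finset.sum_Ico_succ_top hst]
    have ht : (0 : ℝ) < t := by exact_mod_cast (show 0 < t by omega)
    have : 1 / ((t : ℝ) + 1) ^ 2 ≤ 1 / t - 1 / ((t + 1 : ℕ) : ℝ) := by
      push_cast
      rw [div_sub_div _ _ (by positivity) (by positivity), div_le_div_iff₀ (by positivity)
        (by positivity)]
      nlinarith
    linarith

open Classical in
/-- A tail bound for the deficit, uniform in the number of vertices. -/
theorem exists_expect_deficit_tail_le :
    ∃ C : ℝ, 0 ≤ C ∧ ∀ s L n : ℕ, 1 ≤ s → s + 1 ≤ n →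
      𝔼 z : Choices n 4, (if L ≤ deficit z (n - 1) then (1 : ℝ) else 0) ≤
        C / s + (1.005 ^ (s + 1) + 201000) / 1.005 ^ L := by
  obtain ⟨C, hC0, hC⟩ := exists_expect_not_isExpanding_le
  refine ⟨C, hC0, fun s L n hs hn => ?_⟩
  -- Either expansion fails at some time from `s` on, or Markov's inequality applies to `1.005 ^
  -- deficit`.
  have hpt : ∀ z : Choices n 4, (if L ≤ deficit z (n - 1) then (1 : ℝ) else 0) ≤
      ∑ r ∈ Finset.Ico s (n - 1), (if IsExpanding z r then (0 : ℝ) else 1) +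
        (if ∀ r, s ≤ r → r < n - 1 → IsExpanding z r then
          (1.005 : ℝ) ^ deficit z (n - 1) else 0) * (1.005 ^ L)⁻¹ := by
    intro z
    have nn : ∀ r ∈ Finset.Ico s (n - 1), (0 : ℝ) ≤ if IsExpanding z r then (0 : ℝ) else 1 :=
      fun r _ => by split_ifs <;> norm_num
    have nn' := Finset.sum_nonneg nn
    by_cases hall : ∀ r, s ≤ r → r < n - 1 → IsExpanding z r
    · rw [if_pos hall]
      refine le_trans ?_ (le_add_of_nonneg_left nn')
      split_ifs with hL
      · rw [← div_eq_mul_inv, one_le_div (by positivity)]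
        exact pow_le_pow_right₀ (by norm_num) hL
      · positivity
    · rw [if_neg hall, zero_mul, add_zero]
      push Not at hall
      obtain ⟨r, hr, hrn, hz⟩ := hall
      have h1 := Finset.single_le_sum nn (Finset.mem_Ico.2 ⟨hr, hrn⟩)
      rw [if_neg hz] at h1
      refine le_trans ?_ h1
      split_ifs <;> norm_num
  refine (Finset.expect_le_expect fun z _ => hpt z).trans ?_
  rw [Finset.expect_add_distrib, Finset.expect_sum_comm, ← Finset.expect_mul, ← div_eq_mul_inv]
  refine add_le_add ?_ ?_
  · calc ∑ r ∈ Finset.Ico s (n - 1), 𝔼 z : Choices n 4, (if IsExpanding z r then (0 : ℝ) else 1)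
        ≤ ∑ r ∈ Finset.Ico s (n - 1), C * (1 / ((r : ℝ) + 1) ^ 2) := by
          refine Finset.sum_le_sum fun r hr => ?_
          have := (Finset.mem_Ico.1 hr).2
          rw [mul_one_div]
          exact hC n r (by omega)
      _ ≤ C * (1 / s) := by
          rw [← Finset.mul_sum]
          have h1 := sum_Ico_inv_sq_le hs (show s ≤ n - 1 by omega)
          have h2 : (0 : ℝ) ≤ 1 / ((n - 1 : ℕ) : ℝ) := by positivity
          gcongr
          linarith
      _ = C / s := by ring
  · gcongr
    exact expect_pow_deficit_indicator_le s (n - 1) (by omega) (by omega)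

open Classical in
theorem tendsto_choiceMeasure_of_expect {k : ℕ} {S : ∀ n, Set (Choices n k)}
    (h : ∀ ε > 0, ∃ N, ∀ n ≥ N,
      1 - ε < 𝔼 z : Choices n k, if z ∈ S n then (1 : ℝ) else 0) :
    Tendsto (fun n => choiceMeasure n k (S n)) atTop (𝓝 1) := by
  simp only [choiceMeasure_apply]
  rw [← ENNReal.ofReal_one]
  refine ENNReal.tendsto_ofReal (Metric.tendsto_atTop.2 fun ε hε => ?_)
  obtain ⟨N, hN⟩ := h ε hε
  refine ⟨N, fun n hn => ?_⟩
  have h1 : (𝔼 z : Choices n k, if z ∈ S n then (1 : ℝ) else 0) ≤ 1 := by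
    refine (Finset.expect_le_expect (g := fun _ => (1 : ℝ)) fun z _ => ?_).trans
      (Finset.expect_const Finset.univ_nonempty _).le
    split_ifs <;> norm_num
  have h2 := hN n hn
  rw [Real.dist_eq, abs_lt]
  constructor <;> linarith

end UniformAttachment

/-- For every `ω → ∞`, with probability tending to `1` the graph `G_{n,4}` has a matching which
leaves fewer than `ω n` vertices uncovered. -/
theorem theorem2p1 (ω : ℕ → ℝ) (hω : Tendsto ω atTop atTop) :
    Tendsto
      (fun n : ℕ => UniformAttachment.choiceMeasure n 4
        {z | ∃ M : (UniformAttachment.graph z).Subgraph,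
          M.IsMatching ∧ ((M.vertsᶜ).ncard : ℝ) < ω n})
      atTop (𝓝 1) := by
  classical
  obtain ⟨C, hC0, hC⟩ := UniformAttachment.exists_expect_deficit_tail_le
  refine UniformAttachment.tendsto_choiceMeasure_of_expect fun ε hε => ?_
  -- The order matters: `s` makes late failures of expansion rare, then `L` beats the constant
  -- depending on `s`, and finally `n` is large enough that `ω n ≥ L`.
  obtain ⟨s, hs⟩ := exists_nat_gt (C / (ε / 2))
  have hCs : C / ((s + 1 : ℕ) : ℝ) < ε / 2 := by
    rw [div_lt_iff₀ (by positivity)] at hs ⊢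
    push_cast
    nlinarith
  obtain ⟨L, hL⟩ : ∃ L : ℕ, ((1.005 : ℝ) ^ (s + 1 + 1) + 201000) / 1.005 ^ L < ε / 2 := by
    obtain ⟨L, hL⟩ := pow_unbounded_of_one_lt
      (((1.005 : ℝ) ^ (s + 1 + 1) + 201000) / (ε / 2)) (show (1 : ℝ) < 1.005 by norm_num)
    refine ⟨L, ?_⟩
    rw [div_lt_iff₀ (by positivity)] at hL ⊢
    linarith
  obtain ⟨N, hN⟩ := eventually_atTop.1 (hω.eventually_ge_atTop (L : ℝ))
  refine ⟨max N (s + 2), fun n hn => ?_⟩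
  have hnN : N ≤ n := (le_max_left _ _).trans hn
  have hns : s + 2 ≤ n := (le_max_right _ _).trans hn
  have htail := hC (s + 1) L n (by omega) (by omega)
  refine lt_of_lt_of_le (sub_lt_sub_left (htail.trans_lt (add_lt_add hCs hL)) 1 |>.trans_eq' ?_) ?_
  · ring
  · rw [sub_le_iff_le_add, ← Finset.expect_add_distrib]
    refine (Finset.expect_const (Finset.univ_nonempty (α := UniformAttachment.Choices n 4))
      (1 : ℝ)).ge.trans (Finset.expect_le_expect fun z _ => ?_)
    by_cases hz : L ≤ UniformAttachment.deficit z (n - 1)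
    · rw [if_pos hz]
      split_ifs <;> norm_num
    · rw [if_neg hz, if_pos]
      · norm_num
      · refine UniformAttachment.exists_matching_of_deficit_lt (by omega) z ?_
        refine lt_of_lt_of_le ?_ (hN n hnN)
        exact_mod_cast not_le.1 hz
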